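/- Let $\phi=(1+\sqrt5)/2$ be the golden ratio. Let $S$ be the set of all quadruples $(a,b,\kappa,\ell)$ with $a,b\in\mathbb{Q}$ and $\kappa,\ell\in\mathbb{Z}\setminus\{0\}$ such that $|\kappa|\ge|\ell|$, $\kappa+\ell\ne 0$ and $$\frac{\pi}{4}=a\arctan(\phi^{\kappa})+b\arctan(\phi^{\ell}).$$ Then $S$ consists of exactly the following sixteen quadruples: $$\begin{matrix} \left(\tfrac13,\tfrac13,3,1\right), & (1,1,-3,-1), & (-1,1,-3,1), & (1,-1,3,-1),\\[4pt] \left(\tfrac15,\tfrac25,6,2\right), & (1,2,-6,-2), & \left(-\tfrac13,\tfrac23,-6,2\right), & (1,-2,6,-2),\\[4pt] \left(\tfrac17,\tfrac37,5,3\right), & (1,3,-5,-3), & \left(-\tfrac15,\tfrac35,-5,3\right), & (1,-3,5,-3),\\[4pt] \left(-\tfrac12,\tfrac32,5,1\right), & \left(-\tfrac12,\tfrac32,-5,-1\right), & \left(\tfrac14,\tfrac34,-5,1\right), & \left(\tfrac14,\tfrac34,5,-1\right). \end{matrix}$$ In particular, the pairs $(|\kappa|,|\ell|)$ that occur are exactly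 $(3,1)$, $(5,1)$, $(5,3)$ and $(6,2)$. -/

import Mathlib

/-- The quadruple `(a, b, κ, ℓ)` gives a formula
`π / 4 = a * arctan (φ ^ κ) + b * arctan (φ ^ ℓ)`, where `φ = (1 + √5) / 2` is the golden ratio
and the exponents are integers (possibly negative). -/
def IsGoldenMachinFormula (a b : ℚ) (κ ℓ : ℤ) : Prop :=
  Real.pi / 4 =
    (a : ℝ) * Real.arctan (Real.goldenRatio ^ κ) + (b : ℝ) * Real.arctan (Real.goldenRatio ^ ℓ)

/-- The nontrivial formulas `(a, b, κ, ℓ)`: rational coefficients, nonzero integer exponents with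
`|ℓ| ≤ |κ|` and `κ + ℓ ≠ 0`. -/
def goldenMachinFormulas : Set (ℚ × ℚ × ℤ × ℤ) :=
  {q | ∃ (a b : ℚ) (κ ℓ : ℤ), q = (a, b, κ, ℓ) ∧
    κ ≠ 0 ∧ ℓ ≠ 0 ∧ |ℓ| ≤ |κ| ∧ κ + ℓ ≠ 0 ∧ IsGoldenMachinFormula a b κ ℓ}

/-- The explicit table of quadruples `(a, b, κ, ℓ)`. -/
def goldenMachinTable : Set (ℚ × ℚ × ℤ × ℤ) :=
  {(1 / 3, 1 / 3, 3, 1), (1, 1, -3, -1), (-1, 1, -3, 1), (1, -1, 3, -1),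
   (1 / 5, 2 / 5, 6, 2), (1, 2, -6, -2), (-1 / 3, 2 / 3, -6, 2), (1, -2, 6, -2),
   (1 / 7, 3 / 7, 5, 3), (1, 3, -5, -3), (-1 / 5, 3 / 5, -5, 3), (1, -3, 5, -3),
   (-1 / 2, 3 / 2, 5, 1), (-1 / 2, 3 / 2, -5, -1), (1 / 4, 3 / 4, -5, 1), (1 / 4, 3 / 4, 5, -1)}

/-! A relation m·arctan φ^k + n·arctan φ^l ∈ πℤ with integers m, n says that a product of powers of
1 ± iφ^k and 1 ± iφ^l equals its complex conjugate. This identity lives in ℤ[φ, i], so it can be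
reduced modulo odd primes. If m ≠ 0, a prime dividing φ^(2k) + 1 kills one side, which forces n ≠ 0
and makes the prime divide φ^(2l) + 1 (`pow_eq_neg_one_of_arctan_relation`). Since φ^(2k) + 1 always
has an odd prime factor, a nontrivial relation has m, n ≠ 0, and both numbers have the same odd
prime factors.

With g = gcd(k, l), those primes all divide φ^(2g) + 1. Hence k/g and l/g are odd, and passing from
exponent 2g to 2k or 2l creates no new odd prime. A Zsigmondy-type argument bounds the quotient (1 +
x^q)/(1 + x) at x = φ^(2g), normalised by a unit to a rational integer, and leaves four pairs
(`eq_of_goldenSupportLE`).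

Negative exponents reduce to positive ones through arctan φ^(-n) = π/2 - arctan φ^n. The same
theorem shows that no arctan φ^κ with κ ≠ 0 is a rational multiple of π, so (κ, ℓ) determines (a,
b), and checking the table finishes the proof. -/

/-! ### Transfer of identities from ℤ[φ, i] ⊂ ℂ to other rings -/

open Complex in
theorem exists_ringHom_pair_of_golden {F : Type} [CommRing F] (u v : F) (hu : u ^ 2 = u + 1)
    (hv : v ^ 2 = -1) :
    ∃ (R : Type) (_ : CommRing R) (w j : R) (e : R →+* ℂ) (f : R →+* F),
      Function.Injective e ∧ e w = (Real.goldenRatio : ℂ) ∧ e j = I ∧ f w = u ∧ f j = v := by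
  -- The ring is ℤ[φ][i], free over ℤ on 1, φ, i, iφ, and mapping out of it only requires choosing
  -- roots u and v.
  have key : ∀ {A : Type} [CommRing A] (u v : A), u ^ 2 = u + 1 → v ^ 2 = -1 →
      ∃ f : QuadraticAlgebra (QuadraticAlgebra ℤ 1 1) (-1) 0 →+* A, ∀ z,
        f z = z.re.re + z.re.im * u + (z.im.re + z.im.im * u) * v := by
    intro A _ u v hu hv
    refine ⟨{ toFun := fun z => z.re.re + z.re.im * u + (z.im.re + z.im.im * u) * v
              map_one' := ?_, map_mul' := ?_, map_zero' := ?_, map_add' := ?_ }, fun z => rfl⟩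
    · simp [QuadraticAlgebra.re_one, QuadraticAlgebra.im_one]
    · intro x y
      simp
      linear_combination (-(x.re.im * y.re.im : A) - (x.re.im * y.im.im + x.im.im * y.re.im) * v
        + x.im.im * y.im.im) * hu - (x.im.re + x.im.im * u) * (y.im.re + y.im.im * u) * hv
    · simp
    · intro x y
      simp
      ring
  obtain ⟨f, hf⟩ := key u v hu hv
  obtain ⟨e, he⟩ := key (Real.goldenRatio : ℂ) I
    (by exact_mod_cast Real.goldenRatio_sq) I_sq
  refine ⟨_, inferInstance, ⟨⟨0, 1⟩, ⟨0, 0⟩⟩, ⟨⟨0, 0⟩, ⟨1, 0⟩⟩, e, f, ?_, ?_, ?_, ?_, ?_⟩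
  · have irr : ∀ a b : ℤ, (a : ℝ) + b * Real.goldenRatio = 0 → a = 0 ∧ b = 0 := by
      intro a b h
      have hb : b = 0 := by
        by_contra hb
        exact ((Real.goldenRatio_irrational.intCast_mul hb).intCast_add a).ne_zero h
      subst hb
      simpa using h
    rw [injective_iff_map_eq_zero]
    intro z hz
    rw [he] at hz
    have h1 := irr z.re.re z.re.im (by simpa using congrArg Complex.re hz)
    have h2 := irr z.im.re z.im.im (by simpa using congrArg Complex.im hz)
    ext <;> simp [h1, h2]
  all_goals simp [he, hf]

/-! ### Lucas numbers of even index -/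

/-- The Lucas numbers `L (2 * n)` of even index. -/
def lucasEven : ℕ → ℤ
  | 0 => 2
  | 1 => 3
  | n + 2 => 3 * lucasEven (n + 1) - lucasEven n

theorem lucasEven_add_two (n : ℕ) :
    lucasEven (n + 2) = 3 * lucasEven (n + 1) - lucasEven n := rfl

theorem lucasEven_mul_pow {F : Type*} [CommRing F] {u : F} (hu : u ^ 2 = u + 1) (n : ℕ) :
    (lucasEven n : F) * u ^ (2 * n) = u ^ (4 * n) + 1 := by
  suffices h : (lucasEven n : F) * u ^ (2 * n) = u ^ (4 * n) + 1 ∧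
      (lucasEven (n + 1) : F) * u ^ (2 * (n + 1)) = u ^ (4 * (n + 1)) + 1 from h.1
  have h4 : u ^ 4 = 3 * u ^ 2 - 1 := by linear_combination (u ^ 2 + u - 1) * hu
  induction n with
  | zero =>
    refine ⟨by norm_num [lucasEven], ?_⟩
    norm_num [lucasEven]
    linear_combination -h4
  | succ n ih =>
    refine ⟨ih.2, ?_⟩
    obtain ⟨h0, h1⟩ := ih
    rw [lucasEven_add_two]
    push_cast
    linear_combination 3 * u ^ 2 * h1 - u ^ 4 * h0 - (u ^ (4 * n) * u ^ 4 + 1) * h4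

theorem lucasEven_add_two_mul_pow {F : Type*} [CommRing F] {u : F} (hu : u ^ 2 = u + 1) (n : ℕ) :
    ((lucasEven n + 2 : ℤ) : F) * u ^ (2 * n) = (1 + u ^ (2 * n)) ^ 2 := by
  push_cast
  linear_combination lucasEven_mul_pow hu n

/-- Consecutive residues modulo 8 form a cycle of length six. Consequently L + 2 is never divisible
by 8, nor L - 1 by 4. -/
theorem lucasEven_emod_eight (n : ℕ) :
    lucasEven n % 8 = 2 ∨ lucasEven n % 8 = 3 ∨ lucasEven n % 8 = 7 := by
  suffices h : (lucasEven n % 8 = 2 ∧ lucasEven (n + 1) % 8 = 3) ∨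
      (lucasEven n % 8 = 3 ∧ lucasEven (n + 1) % 8 = 7) ∨
      (lucasEven n % 8 = 7 ∧ lucasEven (n + 1) % 8 = 2) ∨
      (lucasEven n % 8 = 2 ∧ lucasEven (n + 1) % 8 = 7) ∨
      (lucasEven n % 8 = 7 ∧ lucasEven (n + 1) % 8 = 3) ∨
      (lucasEven n % 8 = 3 ∧ lucasEven (n + 1) % 8 = 2) by omega
  induction n with
  | zero => simp [lucasEven]
  | succ n ih => rw [lucasEven_add_two]; omega

theorem lucasEven_sq_add_sq (n : ℕ) :
    lucasEven n ^ 2 + lucasEven (n + 1) ^ 2 = 3 * lucasEven n * lucasEven (n + 1) - 5 := by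
  induction n with
  | zero => norm_num [lucasEven]
  | succ n ih => rw [lucasEven_add_two]; linear_combination ih

/-- Conceptually, L + 2 is a unit times the square of 1 + φ^(2n), and 3 is inert in ℤ[φ]. The proof
works instead with the quadratic invariant of the recurrence. -/
theorem nine_dvd_lucasEven_add_two {n : ℕ} (h : 3 ∣ lucasEven n + 2) : 9 ∣ lucasEven n + 2 := by
  obtain ⟨s, hs⟩ := h
  have hinv := lucasEven_sq_add_sq n
  rw [eq_sub_of_add_eq hs] at hinv
  have hb : (3 : ℤ) ∣ lucasEven (n + 1) ^ 2 :=
    ⟨(3 * s - 2) * lucasEven (n + 1) - 3 * s ^ 2 + 4 * s - 3, by linear_combination hinv⟩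
  obtain ⟨t, ht⟩ := Int.prime_three.dvd_of_dvd_pow hb
  rw [ht] at hinv
  have h3 : 4 * s = 3 * (s ^ 2 + t ^ 2 - (3 * s - 2) * t + 1) := by
    linarith
  omega

theorem lucasEven_strictMono : StrictMono lucasEven := by
  refine strictMono_nat_of_lt_succ fun n => ?_
  suffices h : 0 < lucasEven n ∧ lucasEven n < lucasEven (n + 1) from h.2
  induction n with
  | zero => simp [lucasEven]
  | succ n ih => rw [lucasEven_add_two]; omega

/-! ### The normalised quotients (1 + x^q)/(1 + x) -/

/-- The integers `x ^ (-h) * (1 + x ^ (2 * h + 1)) / (1 + x)` as a function of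
`w = (1 + x) ^ 2 / x`. -/
def oddQuotient (w : ℤ) : ℕ → ℤ
  | 0 => 1
  | 1 => w - 3
  | h + 2 => (w - 2) * oddQuotient w (h + 1) - oddQuotient w h

theorem oddQuotient_add_two (w : ℤ) (h : ℕ) :
    oddQuotient w (h + 2) = (w - 2) * oddQuotient w (h + 1) - oddQuotient w h := rfl

theorem oddQuotient_mul {F : Type*} [CommRing F] {x : F} {w : ℤ} (hw : (w : F) * x = (1 + x) ^ 2)
    (h : ℕ) : (oddQuotient w h : F) * x ^ h * (1 + x) = 1 + x ^ (2 * h + 1) := by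
  suffices H : (oddQuotient w h : F) * x ^ h * (1 + x) = 1 + x ^ (2 * h + 1) ∧
      (oddQuotient w (h + 1) : F) * x ^ (h + 1) * (1 + x) = 1 + x ^ (2 * (h + 1) + 1) from H.1
  induction h with
  | zero =>
    refine ⟨by norm_num [oddQuotient], ?_⟩
    norm_num [oddQuotient]
    linear_combination (1 + x) * hw
  | succ h ih =>
    refine ⟨ih.2, ?_⟩
    obtain ⟨h0, h1⟩ := ih
    rw [oddQuotient_add_two]
    push_cast
    linear_combination (1 + x ^ 2) * h1 - x ^ 2 * h0
      + (oddQuotient w (h + 1) : F) * x ^ (h + 1) * (1 + x) * hw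

/-- The point w = 0 is x = -1, where the quotient takes the value (-1)^h (2h + 1). -/
theorem oddQuotient_eq_add_mul (w : ℤ) (h : ℕ) :
    ∃ c : ℤ, oddQuotient w h = (-1) ^ h * (2 * h + 1) + w * c := by
  suffices H : (∃ c : ℤ, oddQuotient w h = (-1) ^ h * (2 * h + 1) + w * c) ∧
      (∃ c : ℤ, oddQuotient w (h + 1) = (-1) ^ (h + 1) * (2 * (h + 1 : ℕ) + 1) + w * c) from H.1
  induction h with
  | zero => exact ⟨⟨0, by simp [oddQuotient]⟩, ⟨1, by simp [oddQuotient]; ring⟩⟩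
  | succ h ih =>
    refine ⟨ih.2, ?_⟩
    obtain ⟨⟨c, hc⟩, ⟨d, hd⟩⟩ := ih
    refine ⟨oddQuotient w (h + 1) - 2 * d - c, ?_⟩
    rw [oddQuotient_add_two]
    push_cast at *
    linear_combination -2 * hd - hc

/-- First-order expansion at w = 0, with 6 clearing the denominator. If a prime q = 2h + 1 ≥ 5
divides w, it shows that q² does not divide the quotient. -/
theorem six_mul_oddQuotient_eq (w : ℤ) (h : ℕ) :
    ∃ c : ℤ, 6 * oddQuotient w h =
      (-1) ^ h * (2 * h + 1) * (6 - h * (h + 1) * w) + w ^ 2 * c := by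
  suffices H : (∃ c : ℤ, 6 * oddQuotient w h =
      (-1) ^ h * (2 * h + 1) * (6 - h * (h + 1) * w) + w ^ 2 * c) ∧
      (∃ c : ℤ, 6 * oddQuotient w (h + 1) =
      (-1) ^ (h + 1) * (2 * (h + 1 : ℕ) + 1) * (6 - (h + 1 : ℕ) * ((h + 1 : ℕ) + 1) * w)
        + w ^ 2 * c) from H.1
  induction h with
  | zero => exact ⟨⟨0, by simp [oddQuotient]⟩, ⟨0, by simp [oddQuotient]; ring⟩⟩
  | succ h ih =>
    refine ⟨ih.2, ?_⟩
    obtain ⟨⟨c, hc⟩, ⟨d, hd⟩⟩ := ih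
    refine ⟨w * d - 2 * d - c - (-1) ^ (h + 1) * (2 * (h + 1) + 1) * ((h + 1) * (h + 2)), ?_⟩
    rw [oddQuotient_add_two]
    push_cast at *
    linear_combination (w - 2) * hd - hc

/-- For odd w the parities repeat as odd, even, odd; the hypothesis says that 3 does not divide 2h +
1. -/
theorem odd_oddQuotient {w : ℤ} {h : ℕ} (hh : h % 3 ≠ 1) : Odd (oddQuotient w h) := by
  rcases Int.even_or_odd w with hw | hw
  · suffices H : Odd (oddQuotient w h) ∧ Odd (oddQuotient w (h + 1)) from H.1
    clear hh
    induction h with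
    | zero => exact ⟨odd_one, hw.sub_odd (by decide)⟩
    | succ h ih =>
      exact ⟨ih.2, ((hw.sub even_two).mul_right _).sub_odd ih.1⟩
  · have H : ∀ m, Odd (oddQuotient w (3 * m)) ∧ Even (oddQuotient w (3 * m + 1)) := by
      intro m
      induction m with
      | zero => exact ⟨odd_one, hw.sub_odd (by decide)⟩
      | succ m ih =>
        have h2 : Odd (oddQuotient w (3 * m + 2)) := (ih.2.mul_left _).sub_odd ih.1
        have h3 : Odd (oddQuotient w (3 * m + 3)) :=
          ((hw.sub_even even_two).mul h2).sub_even ih.2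
        exact ⟨h3, ((hw.sub_even even_two).mul h3).sub_odd h2⟩
    obtain ⟨m, rfl | rfl⟩ : ∃ m, h = 3 * m ∨ h = 3 * m + 2 := ⟨h / 3, by omega⟩
    · exact (H m).1
    · exact ((H m).2.mul_left _).sub_odd (H m).1

theorem two_mul_oddQuotient_le {w : ℤ} (hw : 5 ≤ w) (h : ℕ) :
    0 < oddQuotient w h ∧ 2 * oddQuotient w h ≤ oddQuotient w (h + 1) := by
  induction h with
  | zero => simp [oddQuotient]; omega
  | succ h ih =>
    refine ⟨by omega, ?_⟩
    rw [oddQuotient_add_two]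
    nlinarith [mul_nonneg (sub_nonneg.2 hw) (show 0 ≤ oddQuotient w (h + 1) by omega)]

theorem lt_oddQuotient {w : ℤ} (hw : 5 ≤ w) {k h : ℕ} (hk : 2 * k + 1 < oddQuotient w k)
    (hkh : k ≤ h) : 2 * h + 1 < oddQuotient w h := by
  induction h, hkh using Nat.le_induction with
  | base => exact hk
  | succ h _ ih =>
    have := two_mul_oddQuotient_le hw h
    push_cast
    omega

/-! ### Comparing the odd prime factors of φ^(2k) + 1 and φ^(2l) + 1 -/

/-- Every odd prime of `ℤ[φ]` that divides `φ ^ (2 * k) + 1` also divides `φ ^ (2 * l) + 1`. -/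
def GoldenSupportLE (k l : ℕ) : Prop :=
  ∀ (p : ℕ) [Fact p.Prime], p ≠ 2 → ∀ u : AlgebraicClosure (ZMod p), u ^ 2 = u + 1 →
    u ^ (2 * k) = -1 → u ^ (2 * l) = -1

theorem two_ne_zero_algebraicClosure_zmod (p : ℕ) [Fact p.Prime] (hp : p ≠ 2) :
    (2 : AlgebraicClosure (ZMod p)) ≠ 0 := by
  intro h
  have h2 : ((2 : ℕ) : AlgebraicClosure (ZMod p)) = 0 := by exact_mod_cast h
  rw [CharP.cast_eq_zero_iff _ p] at h2
  exact hp ((Nat.prime_dvd_prime_iff_eq Fact.out Nat.prime_two).1 h2)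

theorem exists_sq_eq_add_one (p : ℕ) [Fact p.Prime] (hp : p ≠ 2) :
    ∃ u : AlgebraicClosure (ZMod p), u ^ 2 = u + 1 := by
  obtain ⟨s, hs⟩ := IsAlgClosed.exists_pow_nat_eq (5 : AlgebraicClosure (ZMod p)) two_pos
  have h2 := two_ne_zero_algebraicClosure_zmod p hp
  refine ⟨(1 + s) / 2, ?_⟩
  field_simp
  linear_combination hs

/-- The integer L + 2 is at least 5 and not divisible by 8, so it is not a power of 2. Modulo an odd
prime factor, (1 + u^(2k))² vanishes. -/
theorem exists_pow_eq_neg_one {k : ℕ} (hk : 0 < k) :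
    ∃ (p : ℕ) (_ : Fact p.Prime) (_ : p ≠ 2) (u : AlgebraicClosure (ZMod p)),
      u ^ 2 = u + 1 ∧ u ^ (2 * k) = -1 := by
  have hlow : 3 ≤ lucasEven k := lucasEven_strictMono.monotone (show 1 ≤ k from hk)
  obtain ⟨p, hp, hp2, hpd⟩ : ∃ p : ℕ, p.Prime ∧ p ≠ 2 ∧ (p : ℤ) ∣ lucasEven k + 2 := by
    by_contra! hcon
    have hpow := Nat.eq_prime_pow_of_unique_prime_dvd (n := (lucasEven k + 2).natAbs) (p := 2)
      (by omega) fun {d} hd hdv => by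
        by_contra hne
        exact hcon d hd hne (Int.natCast_dvd.2 hdv)
    set e := (lucasEven k + 2).natAbs.primeFactorsList.length
    have h8 := lucasEven_emod_eight k
    rcases Nat.lt_or_ge e 3 with he | he
    · interval_cases e <;> omega
    · have := pow_dvd_pow 2 he
      omega
  have := Fact.mk hp
  obtain ⟨u, hu⟩ := exists_sq_eq_add_one p hp2
  refine ⟨p, ⟨hp⟩, hp2, u, hu, ?_⟩
  have h := lucasEven_add_two_mul_pow hu k
  rw [(CharP.intCast_eq_zero_iff _ p _).2 hpd, zero_mul] at h
  linear_combination pow_eq_zero_iff two_ne_zero |>.1 h.symm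

/-- Modulo such a p one has x^(2h + 1) = -1 for x = u^(2g), so the support hypothesis gives x = -1.
Then w vanishes modulo p and the quotient becomes ±(2h + 1). -/
theorem prime_dvd_of_dvd_oddQuotient {g h p : ℕ} (hs : GoldenSupportLE (g * (2 * h + 1)) g)
    (hp : p.Prime) (hp2 : p ≠ 2) (hd : (p : ℤ) ∣ oddQuotient (lucasEven g + 2) h) :
    (p : ℤ) ∣ lucasEven g + 2 ∧ p ∣ 2 * h + 1 := by
  have := Fact.mk hp
  obtain ⟨u, hu⟩ := exists_sq_eq_add_one p hp2
  have hw := lucasEven_add_two_mul_pow hu g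
  have hq := oddQuotient_mul hw h
  rw [(CharP.intCast_eq_zero_iff _ p _).2 hd, zero_mul, zero_mul, ← pow_mul] at hq
  have hx := hs p hp2 u hu (by rw [← mul_assoc]; linear_combination -hq)
  rw [hx] at hw
  have hpw : (p : ℤ) ∣ lucasEven g + 2 := by
    rw [← CharP.intCast_eq_zero_iff (AlgebraicClosure (ZMod p)) p]
    linear_combination -hw
  refine ⟨hpw, ?_⟩
  obtain ⟨c, hc⟩ := oddQuotient_eq_add_mul (lucasEven g + 2) h
  have h1 : (p : ℤ) ∣ (-1) ^ h * (2 * h + 1) := by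
    rw [show (-1 : ℤ) ^ h * (2 * h + 1) = oddQuotient (lucasEven g + 2) h - (lucasEven g + 2) * c
      by linear_combination -hc]
    exact dvd_sub hd (hpw.mul_right c)
  rw [(isUnit_one.neg.pow h).dvd_mul_left] at h1
  exact_mod_cast h1

theorem le_of_unique_prime_dvd {n q : ℕ} (hn : n ≠ 0) (hq : q.Prime)
    (h : ∀ p : ℕ, p.Prime → p ∣ n → p = q) (hsq : ¬ q ^ 2 ∣ n) : n ≤ q := by
  have hpow := Nat.eq_prime_pow_of_unique_prime_dvd hn fun {d} => h d
  set e := n.primeFactorsList.length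
  rcases Nat.lt_or_ge e 2 with he | he
  · rw [hpow]
    exact (Nat.pow_le_pow_right hq.pos (show e ≤ 1 by omega)).trans (pow_one q).le
  · exact absurd (hpow ▸ pow_dvd_pow q he) hsq

theorem le_two_of_goldenSupportLE_three {g : ℕ} (hg : 0 < g) (hs : GoldenSupportLE (g * 3) g) :
    g ≤ 2 := by
  have hlow : 3 ≤ lucasEven g := lucasEven_strictMono.monotone (show 1 ≤ g from hg)
  have hs' : GoldenSupportLE (g * (2 * 1 + 1)) g := hs
  have key := fun p => prime_dvd_of_dvd_oddQuotient (p := p) hs'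
  have hP : oddQuotient (lucasEven g + 2) 1 = lucasEven g + 2 - 3 := rfl
  rw [hP] at key
  have h8 := lucasEven_emod_eight g
  -- The odd part of L - 1, whose residue modulo 8 is 1, 2 or 6. Its only possible prime factor is
  -- 3, and 9 will be excluded.
  obtain ⟨m, hm, hmu⟩ : ∃ m : ℕ, m % 2 = 1 ∧
      (lucasEven g + 2 - 3 = m ∨ lucasEven g + 2 - 3 = 2 * m) := by
    rcases h8 with h8 | h8 | h8
    · exact ⟨(lucasEven g - 1).toNat, by omega, by omega⟩
    · exact ⟨((lucasEven g - 1) / 2).toNat, by omega, by omega⟩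
    · exact ⟨((lucasEven g - 1) / 2).toNat, by omega, by omega⟩
  have hmd : (m : ℤ) ∣ lucasEven g + 2 - 3 := by
    rcases hmu with h | h <;> rw [h]
    exact dvd_mul_left _ _
  have hm3 : m ≤ 3 := by
    refine le_of_unique_prime_dvd (by omega) Nat.prime_three (fun p hp hpm => ?_) fun h9 => ?_
    · have h := key p hp (by rintro rfl; omega) ((Int.natCast_dvd_natCast.2 hpm).trans hmd)
      exact (Nat.prime_dvd_prime_iff_eq hp Nat.prime_three).1 h.2
    -- Here 3 divides w = L + 2, hence so does 9, and w - 3 cannot be divisible by 9.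
    · have := nine_dvd_lucasEven_add_two (n := g) (by omega)
      omega
  by_contra hg2
  have : 18 ≤ lucasEven g := lucasEven_strictMono.monotone (show 3 ≤ g by omega)
  omega

theorem eq_of_goldenSupportLE_prime {g q : ℕ} (hg : 0 < g) (hq : q.Prime) (hq5 : 5 ≤ q)
    (hs : GoldenSupportLE (g * q) g) : g = 1 ∧ q = 5 := by
  have hlow : 3 ≤ lucasEven g := lucasEven_strictMono.monotone (show 1 ≤ g from hg)
  obtain ⟨h, rfl⟩ := hq.odd_of_ne_two (by omega)
  have key := fun p => prime_dvd_of_dvd_oddQuotient (p := p) hs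
  have h3 : h % 3 ≠ 1 := by
    intro h3
    have : 3 = 2 * h + 1 := (Nat.prime_dvd_prime_iff_eq Nat.prime_three hq).1 (by omega)
    omega
  have hodd := odd_oddQuotient (w := lucasEven g + 2) h3
  have hpos := (two_mul_oddQuotient_le (w := lucasEven g + 2) (by omega) h).1
  -- The quotient is odd, its only possible prime factor is q = 2h + 1, and q² does not divide it.
  have hle : (oddQuotient (lucasEven g + 2) h).natAbs ≤ 2 * h + 1 := by
    refine le_of_unique_prime_dvd (by omega) hq (fun p hp hpd => ?_) fun hsq => ?_
    · have hpd' := Int.natCast_dvd.2 hpd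
      have hp2 : p ≠ 2 := by
        rintro rfl
        exact (Int.not_even_iff_odd.2 hodd) (even_iff_two_dvd.2 hpd')
      exact (Nat.prime_dvd_prime_iff_eq hp hq).1 (key p hp hp2 hpd').2
    · have hsq' := Int.natCast_dvd.2 hsq
      obtain ⟨b, hb⟩ := hsq'
      have hw := (key (2 * h + 1) hq (by omega)
        ⟨((2 * h + 1 : ℕ) : ℤ) * b, by rw [hb]; push_cast; ring⟩).1
      obtain ⟨a, ha⟩ := hw
      obtain ⟨c, hc⟩ := six_mul_oddQuotient_eq (lucasEven g + 2) h
      rw [hb, ha] at hc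
      have hne : ((2 * h + 1 : ℕ) : ℤ) ≠ 0 := by omega
      have h6 : ((2 * h + 1 : ℕ) : ℤ) ∣ (-1) ^ h * 6 := by
        refine ⟨6 * b + (-1) ^ h * h * (h + 1) * a - a ^ 2 * c, ?_⟩
        apply mul_left_cancel₀ hne
        push_cast at hc ⊢
        linear_combination -hc
      rw [(isUnit_one.neg.pow h).dvd_mul_left] at h6
      have h6' : 2 * h + 1 ∣ 2 * 3 := by exact_mod_cast h6
      rcases (hq.dvd_mul).1 h6' with h | h
      · have := Nat.le_of_dvd (by norm_num) h
        omega
      · have := Nat.le_of_dvd (by norm_num) h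
        omega
  by_contra hne
  have : 2 * (h : ℤ) + 1 < oddQuotient (lucasEven g + 2) h := by
    -- The quotient at least doubles with h, so one starting value suffices. For g ≥ 2, w ≥ 9 and h
    -- = 2 works. For g = 1, w = 5 and the values are 1, 2, 5, 13: equality at q = 5 is the
    -- exception, so the start is h = 3.
    rcases Nat.lt_or_ge 1 g with hg1 | hg1
    · have h7 : 7 ≤ lucasEven g := lucasEven_strictMono.monotone (show 2 ≤ g from hg1)
      refine lt_oddQuotient (by omega) (k := 2) ?_ (by omega)
      simp only [oddQuotient]
      push_cast
      nlinarith
    · obtain rfl : g = 1 := by omega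
      refine lt_oddQuotient (by omega) (k := 3) ?_ (by omega)
      norm_num [oddQuotient, lucasEven]
  omega

theorem pow_two_mul_of_odd {R : Type*} [CommRing R] {u : R} {g e : ℕ} (he : Odd e)
    (h : u ^ (2 * g) = -1) : u ^ (2 * (g * e)) = -1 := by
  rw [← mul_assoc, pow_mul, h, he.neg_one_pow]

theorem eq_of_goldenSupportLE_mul {g d : ℕ} (hg : 0 < g) (hd : Odd d)
    (hs : GoldenSupportLE (g * d) g) :
    d = 1 ∨ (g = 1 ∧ (d = 3 ∨ d = 5)) ∨ (g = 2 ∧ d = 3) := by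
  have key : ∀ g' q : ℕ, 0 < g' → q.Prime → Odd q → GoldenSupportLE (g' * q) g' →
      (g' = 1 ∧ (q = 3 ∨ q = 5)) ∨ (g' = 2 ∧ q = 3) := by
    intro g' q hg' hq hqo h
    have h2 := hq.two_le
    obtain ⟨r, hr⟩ := hqo
    rcases Nat.lt_or_ge q 5 with h5 | h5
    · obtain rfl : q = 3 := by omega
      have := le_two_of_goldenSupportLE_three hg' h
      omega
    · have := eq_of_goldenSupportLE_prime hg' hq h5 h
      omega
  by_cases hd1 : d = 1
  · exact Or.inl hd1
  right
  obtain ⟨e, he⟩ := d.minFac_dvd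
  have hq := Nat.minFac_prime hd1
  generalize d.minFac = q at he hq
  subst he
  obtain ⟨hqo, heo⟩ := Nat.odd_mul.1 hd
  have h1 := key g q hg hq hqo fun p _ hp u hu h =>
    hs p hp u hu (by rw [← mul_assoc g]; exact pow_two_mul_of_odd heo h)
  by_cases he1 : e = 1
  · simpa [he1] using h1
  exfalso
  obtain ⟨f, hf⟩ := e.minFac_dvd
  have hr := Nat.minFac_prime he1
  generalize e.minFac = r at hf hr
  subst hf
  obtain ⟨hro, hfo⟩ := Nat.odd_mul.1 heo
  -- A second prime factor r of d would make the prime case apply with gq ≥ 3 in place of g, which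
  -- allows only 1 and 2.
  have h2 := key (g * q) r (Nat.mul_pos hg hq.pos) hr hro fun p _ hp u hu h =>
    pow_two_mul_of_odd hqo (hs p hp u hu (by
      rw [show g * (q * (r * f)) = g * q * r * f by ring]; exact pow_two_mul_of_odd hfo h))
  have h3 : 3 ≤ g * q := by
    rcases h1 with ⟨rfl, h | h⟩ | ⟨rfl, h⟩ <;> omega
  omega

theorem eq_of_goldenSupportLE {k l : ℕ} (hl : 0 < l) (hlk : l < k) (hkl : GoldenSupportLE k l)
    (hlk' : GoldenSupportLE l k) :
    (k = 3 ∧ l = 1) ∨ (k = 5 ∧ l = 1) ∨ (k = 5 ∧ l = 3) ∨ (k = 6 ∧ l = 2) := by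
  have hk : 0 < k := hl.trans hlk
  have hg : 0 < Nat.gcd k l := Nat.gcd_pos_of_pos_left l hk
  have common : ∀ (p : ℕ) [Fact p.Prime], p ≠ 2 → ∀ u : AlgebraicClosure (ZMod p),
      u ^ (2 * k) = -1 → u ^ (2 * l) = -1 → u ^ (2 * Nat.gcd k l) = -1 := by
    intro p _ hp u hk' hl'
    -- So u^(2g) = ±1, and the plus sign would give u^(2k) = 1 ≠ -1.
    have h4 : u ^ Nat.gcd (4 * k) (4 * l) = 1 := by
      refine pow_gcd_eq_one.2 ⟨?_, ?_⟩
      · linear_combination (u ^ (2 * k) - 1) * hk'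
      · linear_combination (u ^ (2 * l) - 1) * hl'
    rw [Nat.gcd_mul_left] at h4
    have : (u ^ (2 * Nat.gcd k l) - 1) * (u ^ (2 * Nat.gcd k l) + 1) = 0 := by
      linear_combination h4
    rcases mul_eq_zero.1 this with h | h
    · exfalso
      obtain ⟨c, hc⟩ := Nat.gcd_dvd_left k l
      have h1 : u ^ (2 * k) = 1 := by
        rw [hc, ← mul_assoc, pow_mul, sub_eq_zero.1 h, one_pow]
      apply two_ne_zero_algebraicClosure_zmod p hp
      linear_combination hk' - h1
    · linear_combination h
  -- At an odd prime dividing φ^(2m) + 1, u^(2g) = -1 and u^(2m) = (-1)^d = -1, so d is odd.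
  have aux : ∀ m d : ℕ, 0 < m → m = Nat.gcd k l * d → GoldenSupportLE m (Nat.gcd k l) →
      Odd d := by
    intro m d hm hd hs
    obtain ⟨p, _, hp, u, hu, hum⟩ := exists_pow_eq_neg_one hm
    have h1 := hs p hp u hu hum
    by_contra hodd
    rw [hd, ← mul_assoc, pow_mul, h1, (Nat.not_odd_iff_even.1 hodd).neg_one_pow] at hum
    apply two_ne_zero_algebraicClosure_zmod p hp
    linear_combination hum
  have sk : GoldenSupportLE k (Nat.gcd k l) := fun p _ hp u hu h =>
    common p hp u h (hkl p hp u hu h)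
  have sl : GoldenSupportLE l (Nat.gcd k l) := fun p _ hp u hu h =>
    common p hp u (hlk' p hp u hu h) h
  obtain ⟨c, hc⟩ := Nat.gcd_dvd_left k l
  obtain ⟨d, hd⟩ := Nat.gcd_dvd_right k l
  have oc := aux k c hk hc sk
  have od := aux l d hl hd sl
  generalize Nat.gcd k l = g at *
  subst hc hd
  have h1 := eq_of_goldenSupportLE_mul hg oc sk
  have h2 := eq_of_goldenSupportLE_mul hg od sl
  have h3 : d < c := Nat.lt_of_mul_lt_mul_left hlk
  rcases h1 with rfl | ⟨rfl, rfl | rfl⟩ | ⟨rfl, rfl⟩ <;> omega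

/-! ### From arctangent relations to prime factors -/

open Real in
theorem exp_two_mul_arctan_mul_I (y : ℝ) :
    Complex.exp (2 * (arctan y : ℝ) * Complex.I) * (1 - y * Complex.I) = 1 + y * Complex.I := by
  have hc' := (cos_arctan_pos y).ne'
  have hs' := tan_mul_cos hc'
  rw [tan_arctan] at hs'
  generalize arctan y = A at *
  have hc : (cos A : ℂ) ≠ 0 := Complex.ofReal_ne_zero.2 hc'
  have hs : (sin A : ℂ) = y * cos A := by rw [← hs', Complex.ofReal_mul]
  have h1 : Complex.exp (A * Complex.I) = cos A * (1 + y * Complex.I) := by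
    rw [Complex.exp_mul_I, ← Complex.ofReal_cos, ← Complex.ofReal_sin, hs]
    ring
  have h2 : Complex.exp (-(A * Complex.I)) = cos A * (1 - y * Complex.I) := by
    rw [← neg_mul, Complex.exp_mul_I, Complex.cos_neg, Complex.sin_neg,
      ← Complex.ofReal_cos, ← Complex.ofReal_sin, hs]
    ring
  apply mul_left_cancel₀ hc
  have h3 : Complex.exp (2 * A * Complex.I) * Complex.exp (-(A * Complex.I)) =
      Complex.exp (A * Complex.I) := by
    rw [← Complex.exp_add]
    congr 1
    ring
  rw [h1, h2] at h3
  linear_combination h3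

-- The factors exp(2i·arctan y) = (1 + iy)/(1 - iy) multiply to exp(2πit) = 1. The signs δ and ε
-- keep the exponents natural, so that no division is needed in ℤ[φ, i].
open Real in
theorem prod_pow_eq_of_arctan_relation {M N : ℕ} {δ ε t : ℤ} {y z : ℝ} (hδ : δ = 1 ∨ δ = -1)
    (hε : ε = 1 ∨ ε = -1) (h : (δ * M) * arctan y + (ε * N) * arctan z = t * π) :
    ((1 + δ * y * Complex.I) ^ M * (1 + ε * z * Complex.I) ^ N : ℂ) =
      (1 - δ * y * Complex.I) ^ M * (1 - ε * z * Complex.I) ^ N := by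
  have sign : ∀ {η : ℤ} (w : ℝ), η = 1 ∨ η = -1 →
      Complex.exp (2 * (η * (arctan w : ℝ)) * Complex.I) * (1 - η * w * Complex.I) =
        1 + η * w * Complex.I := by
    rintro η w (rfl | rfl)
    · have hw := exp_two_mul_arctan_mul_I w
      generalize arctan w = A at *
      simpa using hw
    · have hw := exp_two_mul_arctan_mul_I (-w)
      rw [arctan_neg] at hw
      generalize arctan w = A at *
      simpa using hw
  rw [← sign y hδ, ← sign z hε, mul_pow, mul_pow]
  generalize arctan y = A at *
  generalize arctan z = B at *
  have hexp : Complex.exp (2 * (δ * A) * Complex.I) ^ M *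
      Complex.exp (2 * (ε * B) * Complex.I) ^ N = 1 := by
    rw [← Complex.exp_nat_mul, ← Complex.exp_nat_mul, ← Complex.exp_add,
      Complex.exp_eq_one_iff]
    refine ⟨t, ?_⟩
    have h' : ((δ * M * A + ε * N * B : ℝ) : ℂ) = (t * π : ℝ) := by rw [h]
    push_cast at h'
    linear_combination 2 * Complex.I * h'
  linear_combination ((1 - δ * y * Complex.I) ^ M * (1 - ε * z * Complex.I) ^ N) * hexp

open Real in
theorem pow_eq_neg_one_of_arctan_relation {m n t : ℤ} {k l : ℕ} (hm : m ≠ 0)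
    (h : m * arctan (goldenRatio ^ k) + n * arctan (goldenRatio ^ l) = t * π)
    {F : Type} [Field F] (h2 : (2 : F) ≠ 0) {u : F} (hu : u ^ 2 = u + 1)
    (huk : u ^ (2 * k) = -1) : n ≠ 0 ∧ u ^ (2 * l) = -1 := by
  have habs : ∀ a : ℤ, ∃ δ : ℤ, (δ = 1 ∨ δ = -1) ∧ a = δ * a.natAbs := by
    intro a
    rcases Int.natAbs_eq a with ha | ha
    · exact ⟨1, Or.inl rfl, by omega⟩
    · exact ⟨-1, Or.inr rfl, by omega⟩
  obtain ⟨δ, hδ, hmδ⟩ := habs m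
  obtain ⟨ε, hε, hnε⟩ := habs n
  have sq : ∀ η : ℤ, η = 1 ∨ η = -1 → (η : F) ^ 2 = 1 := by
    rintro η (rfl | rfl) <;> simp
  have hid := prod_pow_eq_of_arctan_relation (M := m.natAbs) (N := n.natAbs) (t := t) hδ hε
    (y := goldenRatio ^ k) (z := goldenRatio ^ l) (by
      rw [← h]
      have hm' : (m : ℝ) = δ * m.natAbs := by rw [← Int.cast_natCast, ← Int.cast_mul, ← hmδ]
      have hn' : (n : ℝ) = ε * n.natAbs := by rw [← Int.cast_natCast, ← Int.cast_mul, ← hnε]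
      rw [← hm', ← hn'])
  -- Sending i to v = δu^k makes 1 + δu^k·v = 0 and 1 - δu^k·v = 2. The left side vanishes, so the
  -- other factor on the right, (1 - εu^l·v)^|n|, must vanish.
  have hv : ((δ : F) * u ^ k) ^ 2 = -1 := by
    rw [mul_pow, sq δ hδ, one_mul, ← pow_mul, mul_comm k, huk]
  obtain ⟨R, _, w, j, e, f, he, hew, hej, hfw, hfj⟩ :=
    exists_ringHom_pair_of_golden u ((δ : F) * u ^ k) hu hv
  have hR : (1 + δ * w ^ k * j) ^ m.natAbs * (1 + ε * w ^ l * j) ^ n.natAbs =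
      (1 - δ * w ^ k * j) ^ m.natAbs * (1 - ε * w ^ l * j) ^ n.natAbs := by
    apply he
    simpa [hew, hej] using hid
  have hF := congrArg f hR
  simp only [map_mul, map_pow, map_add, map_sub, map_one, map_intCast, hfw, hfj] at hF
  have hv' : (δ : F) * u ^ k * (δ * u ^ k) = -1 := by rw [← hv]; ring
  rw [hv', add_neg_cancel, zero_pow (by omega), zero_mul, sub_neg_eq_add, one_add_one_eq_two] at hF
  have h0 := (mul_eq_zero.1 hF.symm).resolve_left (pow_ne_zero _ h2)
  refine ⟨?_, ?_⟩
  · rintro rfl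
    simp at h0
  · have h1 : (ε : F) * u ^ l * (δ * u ^ k) = 1 := by
      have := pow_eq_zero_iff (fun hn => by simp [hn] at h0) |>.1 h0
      linear_combination -this
    have h3 : (ε : F) ^ 2 * (u ^ l) ^ 2 * (δ * u ^ k) ^ 2 = 1 := by
      rw [← mul_pow, ← mul_pow, h1, one_pow]
    rw [sq ε hε, hv, ← pow_mul, mul_comm l] at h3
    linear_combination -h3

open Real in
theorem arctan_goldenRatio_pow_linearIndependent {k l : ℕ} (hk : 0 < k) (hl : 0 < l) (hlk : l < k)
    {r s t : ℚ} (h : r * arctan (goldenRatio ^ k) + s * arctan (goldenRatio ^ l) = t * π)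
    (hrs : r ≠ 0 ∨ s ≠ 0) :
    (k = 3 ∧ l = 1) ∨ (k = 5 ∧ l = 1) ∨ (k = 5 ∧ l = 3) ∨ (k = 6 ∧ l = 2) := by
  have hr : (r.num : ℝ) = r * r.den := by exact_mod_cast (Rat.mul_den_eq_num r).symm
  have hs : (s.num : ℝ) = s * s.den := by exact_mod_cast (Rat.mul_den_eq_num s).symm
  have ht : (t.num : ℝ) = t * t.den := by exact_mod_cast (Rat.mul_den_eq_num t).symm
  obtain ⟨m, n, c, hm, hn, hc⟩ : ∃ m n c : ℤ, (r ≠ 0 → m ≠ 0) ∧ (s ≠ 0 → n ≠ 0) ∧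
      m * arctan (goldenRatio ^ k) + n * arctan (goldenRatio ^ l) = c * π := by
    refine ⟨r.num * s.den * t.den, s.num * r.den * t.den, t.num * r.den * s.den, ?_, ?_, ?_⟩
    · simp
    · simp
    · push_cast
      rw [hr, hs, ht]
      linear_combination (r.den * s.den * t.den : ℝ) * h
  have hc' : n * arctan (goldenRatio ^ l) + m * arctan (goldenRatio ^ k) = c * π := by
    rw [← hc, add_comm]
  have hmn : m ≠ 0 ∧ n ≠ 0 := by
    rcases hrs with h | h
    · obtain ⟨p, _, hp, u, hu, huk⟩ := exists_pow_eq_neg_one hk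
      exact ⟨hm h, (pow_eq_neg_one_of_arctan_relation (hm h) hc
        (two_ne_zero_algebraicClosure_zmod p hp) hu huk).1⟩
    · obtain ⟨p, _, hp, u, hu, hul⟩ := exists_pow_eq_neg_one hl
      exact ⟨(pow_eq_neg_one_of_arctan_relation (hn h) hc'
        (two_ne_zero_algebraicClosure_zmod p hp) hu hul).1, hn h⟩
  exact eq_of_goldenSupportLE hl hlk
    (fun p _ hp u hu h => (pow_eq_neg_one_of_arctan_relation hmn.1 hc
      (two_ne_zero_algebraicClosure_zmod p hp) hu h).2)
    (fun p _ hp u hu h => (pow_eq_neg_one_of_arctan_relation hmn.2 hc'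
      (two_ne_zero_algebraicClosure_zmod p hp) hu h).2)

/-! ### Integer exponents and uniqueness of the coefficients -/

open Real in
theorem arctan_goldenRatio_neg (n : ℤ) :
    arctan (goldenRatio ^ (-n)) = π / 2 - arctan (goldenRatio ^ n) := by
  rw [zpow_neg, arctan_inv_of_pos (zpow_pos goldenRatio_pos n)]

open Real in
theorem exists_arctan_goldenRatio_zpow_eq (κ : ℤ) :
    ∃ σ τ : ℚ, σ ≠ 0 ∧
      arctan (goldenRatio ^ κ) = σ * arctan (goldenRatio ^ κ.natAbs) + τ * π := by
  rcases Int.natAbs_eq κ with h | h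
  · refine ⟨1, 0, one_ne_zero, ?_⟩
    have hpow : goldenRatio ^ κ = goldenRatio ^ κ.natAbs := by
      conv_lhs => rw [h, zpow_natCast]
    simp [hpow]
  · refine ⟨-1, 1 / 2, by norm_num, ?_⟩
    nth_rewrite 1 [h]
    rw [arctan_goldenRatio_neg, zpow_natCast]
    push_cast
    ring

open Real in
theorem eq_zero_of_mul_arctan_goldenRatio_zpow {κ : ℤ} (hκ : κ ≠ 0) {r t : ℚ}
    (h : r * arctan (goldenRatio ^ κ) = t * π) : r = 0 := by
  by_contra hr
  obtain ⟨σ, τ, hσ, hA⟩ := exists_arctan_goldenRatio_zpow_eq κ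
  rw [hA] at h
  have hk : 0 < κ.natAbs := Int.natAbs_pos.2 hκ
  have hrσ : r * σ ≠ 0 ∨ (0 : ℚ) ≠ 0 := Or.inl (mul_ne_zero hr hσ)
  have hgen : ∀ l : ℕ, ((r * σ : ℚ) : ℝ) * arctan (goldenRatio ^ κ.natAbs) +
      ((0 : ℚ) : ℝ) * arctan (goldenRatio ^ l) = ((t - r * τ : ℚ) : ℝ) * π := by
    intro l
    push_cast
    linear_combination h
  -- An auxiliary larger exponent, taken with coefficient 0; being at least 7, it belongs to no
  -- exceptional pair.
  obtain ⟨l, hl, hl7⟩ : ∃ l : ℕ, κ.natAbs < l ∧ 7 ≤ l := ⟨κ.natAbs + 7, by omega, by omega⟩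
  have := arctan_goldenRatio_pow_linearIndependent (hk.trans hl) hk hl
    ((add_comm _ _).trans (hgen l)) hrσ.symm
  omega

/-- Eliminating either arctangent leaves (ab' - a'b) times the other as a rational multiple of π. So
this determinant vanishes, and then so do those multiples, which are b' - b and a - a' up to the
factor π/4. -/
theorem IsGoldenMachinFormula.coeff_unique {a b a' b' : ℚ} {κ ℓ : ℤ} (hκ : κ ≠ 0)
    (h : IsGoldenMachinFormula a b κ ℓ) (h' : IsGoldenMachinFormula a' b' κ ℓ) :
    a = a' ∧ b = b' := by
  unfold IsGoldenMachinFormula at h h'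
  have hpi := Real.pi_ne_zero
  have h1 : ((a * b' - a' * b : ℚ) : ℝ) * Real.arctan (Real.goldenRatio ^ κ) =
      (((b' - b) / 4 : ℚ) : ℝ) * Real.pi := by
    push_cast
    linear_combination b * h' - b' * h
  have h2 : ((a * b' - a' * b : ℚ) : ℝ) * Real.arctan (Real.goldenRatio ^ ℓ) =
      (((a - a') / 4 : ℚ) : ℝ) * Real.pi := by
    push_cast
    linear_combination a' * h - a * h'
  have h0 := eq_zero_of_mul_arctan_goldenRatio_zpow hκ h1
  rw [h0, Rat.cast_zero, zero_mul, eq_comm, mul_eq_zero, or_iff_left hpi] at h1 h2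
  have h3 : (b' - b) / 4 = 0 := by exact_mod_cast h1
  have h4 : (a - a') / 4 = 0 := by exact_mod_cast h2
  constructor <;> linarith

theorem IsGoldenMachinFormula.abs_eq {a b : ℚ} {κ ℓ : ℤ} (hκ : κ ≠ 0) (hℓ : ℓ ≠ 0)
    (hle : |ℓ| ≤ |κ|) (hadd : κ + ℓ ≠ 0) (h : IsGoldenMachinFormula a b κ ℓ) :
    (κ.natAbs = 3 ∧ ℓ.natAbs = 1) ∨ (κ.natAbs = 5 ∧ ℓ.natAbs = 1) ∨
      (κ.natAbs = 5 ∧ ℓ.natAbs = 3) ∨ (κ.natAbs = 6 ∧ ℓ.natAbs = 2) := by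
  unfold IsGoldenMachinFormula at h
  rw [Int.abs_eq_natAbs, Int.abs_eq_natAbs] at hle
  rcases (show ℓ.natAbs = κ.natAbs ∨ ℓ.natAbs < κ.natAbs by omega) with heq | hlt
  -- The hypothesis κ + ℓ ≠ 0 rules out ℓ = -κ, where arctan φ^κ + arctan φ^(-κ) = π/2 is a genuine
  -- relation.
  · obtain rfl : ℓ = κ := by omega
    have h1 : ((a + b : ℚ) : ℝ) * Real.arctan (Real.goldenRatio ^ ℓ) =
        ((1 / 4 : ℚ) : ℝ) * Real.pi := by
      push_cast
      linear_combination -h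
    have h0 := eq_zero_of_mul_arctan_goldenRatio_zpow hκ h1
    rw [h0] at h1
    norm_num at h1
  · obtain ⟨σ, τ, hσ, hA⟩ := exists_arctan_goldenRatio_zpow_eq κ
    obtain ⟨σ', τ', hσ', hB⟩ := exists_arctan_goldenRatio_zpow_eq ℓ
    refine arctan_goldenRatio_pow_linearIndependent (r := a * σ) (s := b * σ')
      (t := 1 / 4 - a * τ - b * τ') (by omega) (by omega) hlt ?_ ?_
    · rw [hA, hB] at h
      push_cast
      linear_combination -h
    · by_contra! h0
      have ha : a = 0 := (mul_eq_zero.1 h0.1).resolve_right hσ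
      have hb : b = 0 := (mul_eq_zero.1 h0.2).resolve_right hσ'
      subst ha hb
      norm_num at h

/-! ### Verification of the table -/

theorem inv_goldenRatio_pos_lt_one_sq :
    0 < Real.goldenRatio⁻¹ ∧ Real.goldenRatio⁻¹ < 1 ∧
      Real.goldenRatio⁻¹ ^ 2 = 1 - Real.goldenRatio⁻¹ := by
  refine ⟨inv_pos.2 Real.goldenRatio_pos, inv_lt_one_of_one_lt₀ Real.one_lt_goldenRatio, ?_⟩
  rw [Real.inv_goldenRatio]
  linear_combination Real.goldenConj_sq

theorem isGoldenMachinFormula_neg_three_neg_one : IsGoldenMachinFormula 1 1 (-3) (-1) := by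
  obtain ⟨h0, h1, h2⟩ := inv_goldenRatio_pos_lt_one_sq
  unfold IsGoldenMachinFormula
  rw [zpow_neg, zpow_neg, ← inv_zpow, ← inv_zpow]
  norm_cast
  generalize Real.goldenRatio⁻¹ = x at *
  have h3 : x ^ 3 = 2 * x - 1 := by linear_combination (x - 1) * h2
  have h4 : x ^ 3 * x ^ 1 < 1 := by rw [h3]; nlinarith
  rw [one_mul, one_mul, Real.arctan_add h4, ← Real.arctan_one]
  congr 1
  rw [eq_div_iff (by linarith), h3]
  linear_combination -2 * h2

theorem isGoldenMachinFormula_neg_six_neg_two : IsGoldenMachinFormula 1 2 (-6) (-2) := by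
  obtain ⟨h0, h1, h2⟩ := inv_goldenRatio_pos_lt_one_sq
  unfold IsGoldenMachinFormula
  rw [zpow_neg, zpow_neg, ← inv_zpow, ← inv_zpow]
  norm_cast
  generalize Real.goldenRatio⁻¹ = x at *
  have h6 : x ^ 6 = 5 - 8 * x := by linear_combination (x ^ 4 - x ^ 3 + 2 * x ^ 2 - 3 * x + 5) * h2
  have h5 : 2 * (1 - x) / (1 - (1 - x) ^ 2) = (4 * x + 2) / 5 := by
    rw [div_eq_div_iff (by nlinarith) (by norm_num)]
    linear_combination (4 * x - 10) * h2
  have h4 : (5 - 8 * x) * ((4 * x + 2) / 5) < 1 := by nlinarith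
  rw [h6, h2, one_mul]
  rw [Real.two_mul_arctan (by linarith) (by linarith), h5, Real.arctan_add h4, ← Real.arctan_one]
  congr 1
  rw [eq_div_iff (by linarith)]
  linear_combination 32 / 5 * h2

theorem isGoldenMachinFormula_neg_five_neg_three : IsGoldenMachinFormula 1 3 (-5) (-3) := by
  obtain ⟨h0, h1, h2⟩ := inv_goldenRatio_pos_lt_one_sq
  unfold IsGoldenMachinFormula
  rw [zpow_neg, zpow_neg, ← inv_zpow, ← inv_zpow]
  norm_cast
  generalize Real.goldenRatio⁻¹ = x at *
  have h3 : x ^ 3 = 2 * x - 1 := by linear_combination (x - 1) * h2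
  have h5 : x ^ 5 = 5 * x - 3 := by linear_combination (x ^ 3 - x ^ 2 + 2 * x - 3) * h2
  have hx : 3 / 5 < x := by nlinarith
  have hx' : x < 2 / 3 := by nlinarith
  -- The target splits as Euler's π/4 = arctan(1/2) + arctan(1/3), with 2·arctan φ^(-3) =
  -- arctan(1/2) and arctan φ^(-5) + arctan φ^(-3) = arctan(1/3).
  have hdouble : 2 * Real.arctan (2 * x - 1) = Real.arctan 2⁻¹ := by
    rw [Real.two_mul_arctan (by linarith) (by linarith)]
    congr 1
    rw [div_eq_iff (by nlinarith)]
    linear_combination 2 * h2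
  have hadd : Real.arctan (5 * x - 3) + Real.arctan (2 * x - 1) = Real.arctan 3⁻¹ := by
    rw [Real.arctan_add (by nlinarith)]
    congr 1
    rw [div_eq_iff (by nlinarith)]
    linear_combination 10 / 3 * h2
  rw [h3, h5, ← Real.arctan_inv_2_add_arctan_inv_3]
  linear_combination -hdouble - hadd

theorem isGoldenMachinFormula_of_mem_table {a b : ℚ} {κ ℓ : ℤ}
    (h : (a, b, κ, ℓ) ∈ goldenMachinTable) : IsGoldenMachinFormula a b κ ℓ := by
  -- These three formulas suffice: reflection changes signs of exponents, and eliminating arctan φ^3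
  -- between the first and third gives the pair (5, 1).
  have h31 := isGoldenMachinFormula_neg_three_neg_one
  have h62 := isGoldenMachinFormula_neg_six_neg_two
  have h53 := isGoldenMachinFormula_neg_five_neg_three
  simp only [IsGoldenMachinFormula, arctan_goldenRatio_neg] at h31 h62 h53
  push_cast at h31 h62 h53
  simp only [goldenMachinTable, Set.mem_insert_iff, Set.mem_singleton_iff, Prod.mk.injEq] at h
  rcases h with h | h | h | h | h | h | h | h | h | h | h | h | h | h | h | h <;>
    obtain ⟨rfl, rfl, rfl, rfl⟩ := h <;>
    simp only [IsGoldenMachinFormula, arctan_goldenRatio_neg] <;> push_cast <;> linarith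

theorem exists_mem_table {κ ℓ : ℤ}
    (h : (κ.natAbs = 3 ∧ ℓ.natAbs = 1) ∨ (κ.natAbs = 5 ∧ ℓ.natAbs = 1) ∨
      (κ.natAbs = 5 ∧ ℓ.natAbs = 3) ∨ (κ.natAbs = 6 ∧ ℓ.natAbs = 2)) :
    ∃ a b : ℚ, (a, b, κ, ℓ) ∈ goldenMachinTable := by
  simp only [Int.natAbs_eq_iff] at h
  rcases h with ⟨rfl | rfl, rfl | rfl⟩ | ⟨rfl | rfl, rfl | rfl⟩ | ⟨rfl | rfl, rfl | rfl⟩ |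
    ⟨rfl | rfl, rfl | rfl⟩ <;> simp [goldenMachinTable]

theorem goldenMachinFormulas_eq_table : goldenMachinFormulas = goldenMachinTable := by
  ext ⟨a, b, κ, ℓ⟩
  constructor
  · rintro ⟨a', b', κ', ℓ', heq, hκ, hℓ, hle, hadd, h⟩
    simp only [Prod.mk.injEq] at heq
    obtain ⟨rfl, rfl, rfl, rfl⟩ := heq
    obtain ⟨a', b', hmem⟩ := exists_mem_table (h.abs_eq hκ hℓ hle hadd)
    obtain ⟨rfl, rfl⟩ := h.coeff_unique hκ (isGoldenMachinFormula_of_mem_table hmem)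
    exact hmem
  · intro h
    refine ⟨a, b, κ, ℓ, rfl, ?_⟩
    suffices hc : κ ≠ 0 ∧ ℓ ≠ 0 ∧ |ℓ| ≤ |κ| ∧ κ + ℓ ≠ 0 from
      ⟨hc.1, hc.2.1, hc.2.2.1, hc.2.2.2, isGoldenMachinFormula_of_mem_table h⟩
    simp only [goldenMachinTable, Set.mem_insert_iff, Set.mem_singleton_iff, Prod.mk.injEq] at h
    rcases h with h | h | h | h | h | h | h | h | h | h | h | h | h | h | h | h <;>
      obtain ⟨-, -, rfl, rfl⟩ := h <;> decide

theorem ncard_goldenMachinTable : goldenMachinTable.ncard = 16 := by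
  rw [show goldenMachinTable = (({(1 / 3, 1 / 3, 3, 1), (1, 1, -3, -1), (-1, 1, -3, 1),
    (1, -1, 3, -1), (1 / 5, 2 / 5, 6, 2), (1, 2, -6, -2), (-1 / 3, 2 / 3, -6, 2), (1, -2, 6, -2),
    (1 / 7, 3 / 7, 5, 3), (1, 3, -5, -3), (-1 / 5, 3 / 5, -5, 3), (1, -3, 5, -3),
    (-1 / 2, 3 / 2, 5, 1), (-1 / 2, 3 / 2, -5, -1), (1 / 4, 3 / 4, -5, 1),
    (1 / 4, 3 / 4, 5, -1)} : Finset (ℚ × ℚ × ℤ × ℤ)) : Set (ℚ × ℚ × ℤ × ℤ)) by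
      simp [goldenMachinTable], Set.ncard_coe_finset]
  decide +kernel

theorem mainTheorem2 :
    goldenMachinFormulas = goldenMachinTable ∧
    goldenMachinFormulas.ncard = 16 ∧
    {p : ℤ × ℤ | ∃ (a b : ℚ) (κ ℓ : ℤ), (a, b, κ, ℓ) ∈ goldenMachinFormulas ∧ p = (|κ|, |ℓ|)} =
      {(3, 1), (5, 1), (5, 3), (6, 2)} := by
  rw [goldenMachinFormulas_eq_table]
  refine ⟨rfl, ncard_goldenMachinTable, ?_⟩
  ext p
  simp only [Set.mem_ofPred_eq, Set.mem_insert_iff, Set.mem_singleton_iff]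
  constructor
  · rintro ⟨a, b, κ, ℓ, h, rfl⟩
    simp only [goldenMachinTable, Set.mem_insert_iff, Set.mem_singleton_iff, Prod.mk.injEq] at h
    rcases h with h | h | h | h | h | h | h | h | h | h | h | h | h | h | h | h <;>
      obtain ⟨-, -, rfl, rfl⟩ := h <;> decide
  · rintro (rfl | rfl | rfl | rfl)
    · obtain ⟨a, b, h⟩ := exists_mem_table (κ := 3) (ℓ := 1) (by decide)
      exact ⟨a, b, 3, 1, h, rfl⟩
    · obtain ⟨a, b, h⟩ := exists_mem_table (κ := 5) (ℓ := 1) (by decide)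
      exact ⟨a, b, 5, 1, h, rfl⟩
    · obtain ⟨a, b, h⟩ := exists_mem_table (κ := 5) (ℓ := 3) (by decide)
      exact ⟨a, b, 5, 3, h, rfl⟩
    · obtain ⟨a, b, h⟩ := exists_mem_table (κ := 6) (ℓ := 2) (by decide)
      exact ⟨a, b, 6, 2, h, rfl⟩
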